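/- Let $L,g,H^*,k,l>0$, $0<W^*<\sqrt{gH^*}$ and $V^*=0$. On the rectangle $\Omega=(0,L)\times(0,1)$ consider the linearized two-dimensional Saint-Venant equations for $U=(h,w,v)^T$, $$\partial_t U+\begin{pmatrix}W^*&H^*&0\\ g&W^*&0\\0&0&W^*\end{pmatrix}\partial_xU+\begin{pmatrix}V^*&0&H^*\\0&V^*&0\\ g&0&V^*\end{pmatrix}\partial_yU=\begin{pmatrix}0&0&0\\0&-k&l\\0&-l&-k\end{pmatrix}U ,$$ and put $\tilde h=\sqrt{g/H^*}\,h$. Impose the solid-wall conditions $v(t,x,1)=0$ for $x\in(0,L)$ and $v(t,x,0)=0$ for $x\in(0,\tfrac L3)\cup(\tfrac{2L}3,L)$, and, with real constants $k_1,k_2,k_3,k_4$, the feedback laws $$[\tilde h-w](t,L,y)=k_1[\tilde h+w](t,L,y),\qquad [\tilde h+w](t,0,y)=k_2[\tilde h-w](t,0,y),\qquad y\in(0,1),$$ $$[\tilde h+v](t,x,0)=k_3[\tilde h-v](t,x,0),\qquad x\in(\tfrac L3,\tfrac{2L}3),$$ $$v(t,0,y)=k_4[\tilde h-v]\bigl(t,\tfrac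 L3(y+1),0\bigr),\qquad y\in(0,1).$$ An $L^2$-solution on $[0,T]$ is a function $U\in C([0,T];L^2(\Omega)^3)$ that is the limit in $C([0,T];L^2(\Omega)^3)$ of functions $U_n$ of class $C^1$ on $[0,T]\times\overline\Omega$ which satisfy all these boundary conditions and for which the difference of the two sides of the system tends to $0$ in $L^2((0,T)\times\Omega)$ (this includes the solutions of class $C^1$ up to the boundary); a global $L^2$-solution is one whose restriction to $[0,T]$ is an $L^2$-solution for every $T>0$. The quadratic polynomial $$q(r)=\frac{W^*}{2\sqrt{gH^*}}\,r^2+r+\frac{W^*}{2\sqrt{gH^*}}$$ has exactly two real roots $r_1<r_2$. For every $k_3\in(-1,1)$ there is $\delta>0$ such that for all $k_1\in(-1,1)$, all $k_2\ne-1$ with $\frac{k_2-1}{k_2+1}\in[r_1,r_2]$ and all $k_4$ with $|k_4|\le\delta$ the following holds. (a) For all boundary values of $U=(h,w,v)$ that are square integrable on the four sides of $\Omega$ and satisfy the boundary conditions, $$\mathcal{BC}=\int_{\partial\Omega}(2L-x)\,\tilde U^T(n_1A_1+n_2A_2)\tilde U\,d\ell\ \ge 0,$$ where $\tilde U=(\tilde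 h,w,v)^T$, $(n_1,n_2)$ is the outward unit normal, and $$A_1=\begin{pmatrix}W^*&\sqrt{gH^*}&0\\ \sqrt{gH^*}&W^*&0\\0&0&W^*\end{pmatrix},\qquad A_2=\begin{pmatrix}V^*&0&\sqrt{gH^*}\\0&V^*&0\\ \sqrt{gH^*}&0&V^*\end{pmatrix}.$$ (b) There are constants $C,\nu>0$ such that every global $L^2$-solution satisfies $\|U(t)\|_{L^2(\Omega)}\le Ce^{-\nu t}\|U(0)\|_{L^2(\Omega)}$ for all $t\ge0$; the same bound, with the same $C$ and $\nu$, holds on $[0,T]$ for every $L^2$-solution on $[0,T]$, for every $T>0$. -/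

import Mathlib

open MeasureTheory Set Filter Topology
open scoped Matrix

noncomputable section

/-- The constants of the channel problem: the length `L` of the channel `(0,L) × (0,1)`, the
gravity constant `g`, the steady state `(Hs, Ws, Vs)` (depth and velocities), the viscous drag
coefficient `k` and the Coriolis coefficient `l`. Their signs are hypotheses of the theorem. -/
structure Channel where
  L : ℝ
  g : ℝ
  Hs : ℝ
  Ws : ℝ
  Vs : ℝ
  k : ℝ
  l : ℝ

/-- Values `(h, w, v)` of the unknown: the deviations of depth, `x`-velocity and `y`-velocity from
the steady state, with components `0, 1, 2`. -/
abbrev State : Type := EuclideanSpace ℝ (Fin 3)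

namespace Channel

variable (p : Channel)

/-- The open channel `(0,L) × (0,1)`. -/
def domain : Set (ℝ × ℝ) := Ioo 0 p.L ×ˢ Ioo 0 1

/-- The space `L²((0,L) × (0,1); ℝ³)`. -/
abbrev L2 : Type := Lp State 2 (volume.restrict p.domain)

/-- The `x`-coefficient of the linearized Saint-Venant system
`∂ₜU + Abar₁ ∂ₓU + Abar₂ ∂ᵧU = B U` for `U = (h, w, v)`. -/
def Abar₁ : Matrix (Fin 3) (Fin 3) ℝ :=
  !![p.Ws, p.Hs, 0; p.g, p.Ws, 0; 0, 0, p.Ws]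

/-- The `y`-coefficient of the linearized Saint-Venant system. -/
def Abar₂ : Matrix (Fin 3) (Fin 3) ℝ :=
  !![p.Vs, 0, p.Hs; 0, p.Vs, 0; p.g, 0, p.Vs]

/-- The source matrix of the linearized Saint-Venant system. -/
def B : Matrix (Fin 3) (Fin 3) ℝ :=
  !![0, 0, 0; 0, -p.k, p.l; 0, -p.l, -p.k]

/-- The wave speed `√(g H*)`. -/
def c : ℝ := √(p.g * p.Hs)

/-- The coefficient `A₁` of the symmetric form of the system, for `(htilde, w, v)`. -/
def A₁ : Matrix (Fin 3) (Fin 3) ℝ :=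
  !![p.Ws, p.c, 0; p.c, p.Ws, 0; 0, 0, p.Ws]

/-- The coefficient `A₂` of the symmetric form of the system, for `(htilde, w, v)`. -/
def A₂ : Matrix (Fin 3) (Fin 3) ℝ :=
  !![p.Vs, 0, p.c; 0, p.Vs, 0; p.c, 0, p.Vs]

/-- The rescaled depth deviation `htilde = √(g / H*) h`. -/
def htilde (u : State) : ℝ := √(p.g / p.Hs) * u 0

/-- The symmetric variables `(htilde, w, v)`. -/
def symVar (u : State) : Fin 3 → ℝ := ![p.htilde u, u 1, u 2]

/-- The quadratic form `Uᵀ (n₁ A₁ + n₂ A₂) U` in the symmetric variables `U = (htilde, w, v)`. -/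
def normalFlux (n₁ n₂ : ℝ) (u : State) : ℝ :=
  p.symVar u ⬝ᵥ ((n₁ • p.A₁ + n₂ • p.A₂) *ᵥ p.symVar u)

/-- The weight `2L - x` of the Lyapunov function. -/
def weight (x : ℝ) : ℝ := 2 * p.L - x

/-- The boundary term `∫_{∂Ω} (2L - x) Uᵀ (n₁ A₁ + n₂ A₂) U dℓ` over the four sides of the
rectangle, `(n₁, n₂)` being the outward unit normal and `U = (htilde, w, v)`. -/
def boundaryTerm (u : ℝ → ℝ → State) : ℝ :=
  (∫ x in (0 : ℝ)..p.L, p.weight x * p.normalFlux 0 (-1) (u x 0)) +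
  (∫ x in (0 : ℝ)..p.L, p.weight x * p.normalFlux 0 1 (u x 1)) +
  (∫ y in (0 : ℝ)..1, p.weight p.L * p.normalFlux 1 0 (u p.L y)) +
  (∫ y in (0 : ℝ)..1, p.weight 0 * p.normalFlux (-1) 0 (u 0 y))

/-- The boundary conditions on a field `u = (h, w, v)` at a fixed time: solid walls on the banks
outside the spillway `(L/3, 2L/3) × {0}`, and the feedback laws with gains `k₁, k₂, k₃, k₄`. -/
structure BoundaryLaws (k₁ k₂ k₃ k₄ : ℝ) (u : ℝ → ℝ → State) : Prop where
  upper_bank : ∀ x ∈ Ioo 0 p.L, u x 1 2 = 0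
  lower_bank : ∀ x ∈ Ioo 0 (p.L / 3) ∪ Ioo (2 * p.L / 3) p.L, u x 0 2 = 0
  right_gate : ∀ y ∈ Ioo (0 : ℝ) 1,
    p.htilde (u p.L y) - u p.L y 1 = k₁ * (p.htilde (u p.L y) + u p.L y 1)
  left_gate : ∀ y ∈ Ioo (0 : ℝ) 1,
    p.htilde (u 0 y) + u 0 y 1 = k₂ * (p.htilde (u 0 y) - u 0 y 1)
  spillway : ∀ x ∈ Ioo (p.L / 3) (2 * p.L / 3),
    p.htilde (u x 0) + u x 0 2 = k₃ * (p.htilde (u x 0) - u x 0 2)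
  left_gate_transverse : ∀ y ∈ Ioo (0 : ℝ) 1,
    u 0 y 2 = k₄ * (p.htilde (u (p.L / 3 * (y + 1)) 0) - u (p.L / 3 * (y + 1)) 0 2)

/-- The values of `u` on the four sides of the rectangle are square integrable. -/
structure SquareIntegrableTraces (u : ℝ → ℝ → State) : Prop where
  lower : MemLp (fun x => u x 0) 2 (volume.restrict (Ioo 0 p.L))
  upper : MemLp (fun x => u x 1) 2 (volume.restrict (Ioo 0 p.L))
  left : MemLp (fun y => u 0 y) 2 (volume.restrict (Ioo 0 1))
  right : MemLp (fun y => u p.L y) 2 (volume.restrict (Ioo 0 1))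

/-- The residual `∂ₜU + Abar₁ ∂ₓU + Abar₂ ∂ᵧU - B U` at an interior point `z = (t, x, y)`. -/
def residual (U : ℝ → ℝ → ℝ → State) (z : ℝ × ℝ × ℝ) : State :=
  deriv (fun t => U t z.2.1 z.2.2) z.1
    + Matrix.toEuclideanLin p.Abar₁ (deriv (fun x => U z.1 x z.2.2) z.2.1)
    + Matrix.toEuclideanLin p.Abar₂ (deriv (fun y => U z.1 z.2.1 y) z.2.2)
    - Matrix.toEuclideanLin p.B (U z.1 z.2.1 z.2.2)

/-- `U ∈ C([0,T]; L²)` is an `L²`-solution on `[0,T]` of the linearized Saint-Venant system with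
the boundary laws (a strong solution in the sense of Friedrichs): it is the limit in
`C([0,T]; L²)` of fields of class `C¹` on the closed set `[0,T] × [0,L] × [0,1]` which satisfy the
boundary laws exactly and whose residuals tend to `0` in `L²((0,T) × (0,L) × (0,1))`.
In particular every solution of class `C¹` up to the boundary is an `L²`-solution. -/
def IsL2SolutionOn (k₁ k₂ k₃ k₄ T : ℝ) (U : ℝ → p.L2) : Prop :=
  ContinuousOn U (Icc 0 T) ∧
  ∃ Un : ℕ → ℝ → ℝ → ℝ → State,
    (∀ n, ContDiffOn ℝ 1 (fun z : ℝ × ℝ × ℝ => Un n z.1 z.2.1 z.2.2)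
      (Icc 0 T ×ˢ Icc 0 p.L ×ˢ Icc 0 1)) ∧
    (∀ n, ∀ t ∈ Icc 0 T, p.BoundaryLaws k₁ k₂ k₃ k₄ (Un n t)) ∧
    Tendsto (fun n => eLpNorm (p.residual (Un n)) 2
      (volume.restrict (Ioo 0 T ×ˢ p.domain))) atTop (𝓝 0) ∧
    Tendsto (fun n => ⨆ t ∈ Icc 0 T, eLpNorm (fun z : ℝ × ℝ => Un n t z.1 z.2 - U t z) 2
      (volume.restrict p.domain)) atTop (𝓝 0)

/-- A global `L²`-solution, on `[0,∞)`. -/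
def IsL2Solution (k₁ k₂ k₃ k₄ : ℝ) (U : ℝ → p.L2) : Prop :=
  ∀ T > 0, p.IsL2SolutionOn k₁ k₂ k₃ k₄ T U

/-- The quadratic that restricts `k₂`, as a function of `r = (k₂ - 1) / (k₂ + 1)`. -/
def gateQuadratic (r : ℝ) : ℝ :=
  p.Ws / (2 * √(p.g * p.Hs)) * r ^ 2 + r + p.Ws / (2 * √(p.g * p.Hs))

end Channel

end

/-!
The proof is an energy estimate. In the symmetric variables `Ũ = (htilde, w, v)` the system is
symmetric hyperbolic, so for a weight `M - x` the time derivative of the energy `∫ (M - x) |Ũ|²`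
consists of

* minus a boundary term, the integral of `(M - x) Ũᵀ (n₁ A₁ + n₂ A₂) Ũ` over the sides of the channel;
* a bulk term with density `-(Ũᵀ A₁ Ũ) - 2k (M - x) (w² + v²)`, which comes from the derivative of
  the weight and from the drag, since the Coriolis terms cancel.

*Boundary term.* In the Riemann invariants `htilde ± w` the right gate has outgoing flux because
`|k₁| < 1`; at the left gate `w = r htilde` with `r = (k₂ - 1) / (k₂ + 1)`, and the sign of the flux
of `(htilde, w)` is that of `-q(r) ≥ 0`. What enters at the left gate through `v² = k₄² (htilde - v)²`
is paid for by the spillway, where the outgoing flux is `c (1 - k₃²) / 2 · (htilde - v)²`. This gives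
`weightedBoundaryTerm_nonneg`, for every `M ≥ 2L` with the same bound on `k₄`; `M = 2L` is the
assertion on the boundary term.

*Bulk term.* The subcritical form `Ũᵀ A₁ Ũ` is indefinite, and the weight `2L - x` need not give decay
when the drag is weak. For `M = 2L + c² / (kW*)` the drag `2k (M - x) w²` absorbs the mixed term
`2 c htilde w`, and the density is at most `-(W*/2) |Ũ|²` (`bulk_density_le`).

Applied to `e^{2νt} (M - x) |Ũ|²`, the divergence theorem on the box `(0,t) × (0,L) × (0,1)`
(`integral_divergence_box`) then bounds the energy of a field of class `C¹` by its initial value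
times `e^{-2νt}`, plus a multiple of the squared `L²`-norm of the residual (`weighted_energy_le`).
For the approximations of an `L²`-solution the residual tends to `0`, and the decay passes to the
limit.
-/

/-! ### The divergence theorem on a space-time box -/

theorem integrableOn_openBox {E : Type*} [NormedAddCommGroup E] {T L : ℝ} {f : ℝ × ℝ × ℝ → E}
    (hf : ContinuousOn f (Icc 0 T ×ˢ Icc 0 L ×ˢ Icc 0 1)) :
    IntegrableOn f (Ioo 0 T ×ˢ Ioo 0 L ×ˢ Ioo 0 1) :=
  (hf.integrableOn_compact (isCompact_Icc.prod (isCompact_Icc.prod isCompact_Icc))).mono_set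
    (prod_mono Ioo_subset_Icc_self (prod_mono Ioo_subset_Icc_self Ioo_subset_Icc_self))

/-- The partial derivatives of a function of class `C¹` on a closed box extend continuously from
the interior of the box. -/
theorem exists_continuousOn_partialDeriv {E : Type*} [NormedAddCommGroup E] [NormedSpace ℝ E]
    {T L : ℝ} (hT : 0 < T) (hL : 0 < L) {f : ℝ × ℝ × ℝ → E}
    (hf : ContDiffOn ℝ 1 f (Icc 0 T ×ˢ Icc 0 L ×ˢ Icc 0 1)) :
    ∃ Dt Dx Dy : ℝ × ℝ × ℝ → E,
      ContinuousOn Dt (Icc 0 T ×ˢ Icc 0 L ×ˢ Icc 0 1) ∧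
      ContinuousOn Dx (Icc 0 T ×ˢ Icc 0 L ×ˢ Icc 0 1) ∧
      ContinuousOn Dy (Icc 0 T ×ˢ Icc 0 L ×ˢ Icc 0 1) ∧
      ∀ t ∈ Ioo 0 T, ∀ x ∈ Ioo 0 L, ∀ y ∈ Ioo (0 : ℝ) 1,
        HasDerivAt (fun s => f (s, x, y)) (Dt (t, x, y)) t ∧
        HasDerivAt (fun s => f (t, s, y)) (Dx (t, x, y)) x ∧
        HasDerivAt (fun s => f (t, x, s)) (Dy (t, x, y)) y := by
  set A : Set (ℝ × ℝ × ℝ) := Icc 0 T ×ˢ Icc 0 L ×ˢ Icc 0 1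
  have hint : interior A = Ioo 0 T ×ˢ Ioo 0 L ×ˢ Ioo 0 1 := by
    simp only [A, interior_prod_eq, interior_Icc]
  have hA : UniqueDiffOn ℝ A := by
    refine uniqueDiffOn_convex ((convex_Icc _ _).prod ((convex_Icc _ _).prod (convex_Icc _ _))) ?_
    rw [hint]
    exact (nonempty_Ioo.2 hT).prod ((nonempty_Ioo.2 hL).prod (nonempty_Ioo.2 zero_lt_one))
  have hc := hf.continuousOn_fderivWithin hA le_rfl
  refine ⟨fun z => fderivWithin ℝ f A z (1, 0, 0), fun z => fderivWithin ℝ f A z (0, 1, 0),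
    fun z => fderivWithin ℝ f A z (0, 0, 1), hc.clm_apply continuousOn_const,
    hc.clm_apply continuousOn_const, hc.clm_apply continuousOn_const, fun t ht x hx y hy => ?_⟩
  have hmem : A ∈ 𝓝 (t, x, y) := mem_interior_iff_mem_nhds.1 (by rw [hint]; exact ⟨ht, hx, hy⟩)
  have hd : HasFDerivAt f (fderivWithin ℝ f A (t, x, y)) (t, x, y) :=
    ((hf.differentiableOn one_ne_zero _ (mem_of_mem_nhds hmem)).hasFDerivWithinAt).hasFDerivAt hmem
  exact ⟨hd.comp_hasDerivAt t ((hasDerivAt_id t).prodMk (hasDerivAt_const t (x, y))),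
    hd.comp_hasDerivAt x
      ((hasDerivAt_const x t).prodMk ((hasDerivAt_id x).prodMk (hasDerivAt_const x y))),
    hd.comp_hasDerivAt y
      ((hasDerivAt_const y t).prodMk ((hasDerivAt_const y x).prodMk (hasDerivAt_id y)))⟩

theorem setIntegral_deriv_Ioo {a b : ℝ} (hab : a ≤ b) {f f' : ℝ → ℝ} (hf : ContinuousOn f (Icc a b))
    (hf' : ContinuousOn f' (Icc a b)) (h : ∀ x ∈ Ioo a b, HasDerivAt f (f' x) x) :
    ∫ x in Ioo a b, f' x = f b - f a := by
  rw [← integral_Ioc_eq_integral_Ioo, ← intervalIntegral.integral_of_le hab]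
  exact intervalIntegral.integral_eq_sub_of_hasDerivAt_of_le hab hf h
    (hf'.intervalIntegrable_of_Icc hab)

theorem setIntegral_openBox_eq {T L : ℝ} {f : ℝ × ℝ × ℝ → ℝ}
    (hf : IntegrableOn f (Ioo 0 T ×ˢ Ioo 0 L ×ˢ Ioo 0 1)) :
    ∫ z in Ioo 0 T ×ˢ Ioo 0 L ×ˢ Ioo 0 1, f z
        = ∫ t in Ioo 0 T, ∫ w in Ioo 0 L ×ˢ Ioo 0 1, f (t, w) ∧
    ∫ z in Ioo 0 T ×ˢ Ioo 0 L ×ˢ Ioo 0 1, f z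
        = ∫ w in Ioo 0 L ×ˢ Ioo 0 1, ∫ t in Ioo 0 T, f (t, w) := by
  rw [IntegrableOn, Measure.volume_eq_prod, ← Measure.prod_restrict] at hf
  rw [Measure.volume_eq_prod ℝ (ℝ × ℝ), ← Measure.prod_restrict]
  exact ⟨integral_prod _ hf, integral_prod_symm _ hf⟩

theorem setIntegral_rect_eq {L : ℝ} {f : ℝ × ℝ → ℝ} (hf : IntegrableOn f (Ioo 0 L ×ˢ Ioo 0 1)) :
    ∫ w in Ioo 0 L ×ˢ Ioo 0 1, f w = ∫ x in Ioo 0 L, ∫ y in Ioo 0 1, f (x, y) ∧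
    ∫ w in Ioo 0 L ×ˢ Ioo 0 1, f w = ∫ y in Ioo 0 1, ∫ x in Ioo 0 L, f (x, y) := by
  rw [IntegrableOn, Measure.volume_eq_prod, ← Measure.prod_restrict] at hf
  rw [Measure.volume_eq_prod ℝ ℝ, ← Measure.prod_restrict]
  exact ⟨integral_prod _ hf, integral_prod_symm _ hf⟩

/-- The divergence theorem for a vector field `(F, G, K)` on `(0,T) × (0,L) × (0,1)`, where `D₁ F`,
`D₂ G`, `D₃ K` are given as functions continuous up to the boundary. -/
theorem integral_divergence_box {T L : ℝ} (hT : 0 < T) (hL : 0 < L)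
    {F G K DF DG DK : ℝ × ℝ × ℝ → ℝ}
    (hF : ContinuousOn F (Icc 0 T ×ˢ Icc 0 L ×ˢ Icc 0 1))
    (hG : ContinuousOn G (Icc 0 T ×ˢ Icc 0 L ×ˢ Icc 0 1))
    (hK : ContinuousOn K (Icc 0 T ×ˢ Icc 0 L ×ˢ Icc 0 1))
    (hDF : ContinuousOn DF (Icc 0 T ×ˢ Icc 0 L ×ˢ Icc 0 1))
    (hDG : ContinuousOn DG (Icc 0 T ×ˢ Icc 0 L ×ˢ Icc 0 1))
    (hDK : ContinuousOn DK (Icc 0 T ×ˢ Icc 0 L ×ˢ Icc 0 1))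
    (h : ∀ t ∈ Ioo 0 T, ∀ x ∈ Ioo 0 L, ∀ y ∈ Ioo (0 : ℝ) 1,
      HasDerivAt (fun s => F (s, x, y)) (DF (t, x, y)) t ∧
      HasDerivAt (fun s => G (t, s, y)) (DG (t, x, y)) x ∧
      HasDerivAt (fun s => K (t, x, s)) (DK (t, x, y)) y) :
    ∫ z in Ioo 0 T ×ˢ Ioo 0 L ×ˢ Ioo 0 1, (DF z + (DG z + DK z)) =
      (∫ w in Ioo 0 L ×ˢ Ioo 0 1, F (T, w)) - (∫ w in Ioo 0 L ×ˢ Ioo 0 1, F (0, w)) +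
      ∫ t in Ioo 0 T,
        (((∫ y in (0 : ℝ)..1, G (t, L, y)) - ∫ y in (0 : ℝ)..1, G (t, 0, y)) +
        ((∫ x in (0 : ℝ)..L, K (t, x, 1)) - ∫ x in (0 : ℝ)..L, K (t, x, 0))) := by
  have iF := integrableOn_openBox hDF
  have iGK : IntegrableOn (fun z => DG z + DK z) (Ioo 0 T ×ˢ Ioo 0 L ×ˢ Ioo 0 1) :=
    integrableOn_openBox (hDG.add hDK)
  have hrect : ∀ {f : ℝ × ℝ → ℝ}, ContinuousOn f (Icc 0 L ×ˢ Icc 0 1) →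
      IntegrableOn f (Ioo 0 L ×ˢ Ioo 0 1) := fun hf =>
    (hf.integrableOn_compact (isCompact_Icc.prod isCompact_Icc)).mono_set
      (prod_mono Ioo_subset_Icc_self Ioo_subset_Icc_self)
  have slice : ∀ {f : ℝ × ℝ × ℝ → ℝ}, ContinuousOn f (Icc 0 T ×ˢ Icc 0 L ×ˢ Icc 0 1) →
      ∀ t ∈ Icc 0 T, ContinuousOn (fun w => f (t, w)) (Icc 0 L ×ˢ Icc 0 1) := fun hf t ht =>
    hf.comp (by fun_prop) fun w hw => ⟨ht, hw⟩
  have eF : ∫ z in Ioo 0 T ×ˢ Ioo 0 L ×ˢ Ioo 0 1, DF z =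
      (∫ w in Ioo 0 L ×ˢ Ioo 0 1, F (T, w)) - ∫ w in Ioo 0 L ×ˢ Ioo 0 1, F (0, w) := by
    rw [(setIntegral_openBox_eq iF).2, ← integral_sub
      (hrect (slice hF T ⟨hT.le, le_rfl⟩)) (hrect (slice hF 0 ⟨le_rfl, hT.le⟩))]
    refine setIntegral_congr_fun (measurableSet_Ioo.prod measurableSet_Ioo) fun w hw => ?_
    have hw' : w ∈ Icc 0 L ×ˢ Icc (0 : ℝ) 1 :=
      ⟨Ioo_subset_Icc_self hw.1, Ioo_subset_Icc_self hw.2⟩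
    exact setIntegral_deriv_Ioo hT.le (hF.comp (by fun_prop) fun t ht => ⟨ht, hw'⟩)
      (hDF.comp (by fun_prop) fun t ht => ⟨ht, hw'⟩) fun t ht => (h t ht w.1 hw.1 w.2 hw.2).1
  rw [integral_add iF iGK, eF, (setIntegral_openBox_eq iGK).1]
  congr 1
  refine setIntegral_congr_fun measurableSet_Ioo fun t ht => ?_
  have ht' := Ioo_subset_Icc_self ht
  have jG := hrect (slice hDG t ht')
  have jK := hrect (slice hDK t ht')
  rw [integral_add jG jK, (setIntegral_rect_eq jG).2, (setIntegral_rect_eq jK).1]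
  have vert : ∀ {f : ℝ × ℝ × ℝ → ℝ}, ContinuousOn f (Icc 0 T ×ˢ Icc 0 L ×ˢ Icc 0 1) →
      ∀ x ∈ Icc 0 L, ContinuousOn (fun y => f (t, x, y)) (Icc 0 1) := fun hf x hx =>
    hf.comp (by fun_prop) fun y hy => ⟨ht', hx, hy⟩
  have hor : ∀ {f : ℝ × ℝ × ℝ → ℝ}, ContinuousOn f (Icc 0 T ×ˢ Icc 0 L ×ˢ Icc 0 1) →
      ∀ y ∈ Icc (0 : ℝ) 1, ContinuousOn (fun x => f (t, x, y)) (Icc 0 L) := fun hf y hy =>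
    hf.comp (by fun_prop) fun x hx => ⟨ht', hx, hy⟩
  congr 1
  · rw [← intervalIntegral.integral_sub
      ((vert hG L ⟨hL.le, le_rfl⟩).intervalIntegrable_of_Icc zero_le_one)
      ((vert hG 0 ⟨le_rfl, hL.le⟩).intervalIntegrable_of_Icc zero_le_one),
      intervalIntegral.integral_of_le zero_le_one, integral_Ioc_eq_integral_Ioo]
    refine setIntegral_congr_fun measurableSet_Ioo fun y hy => ?_
    have hy' := Ioo_subset_Icc_self hy
    exact setIntegral_deriv_Ioo hL.le (hor hG y hy') (hor hDG y hy')
      fun x hx => (h t ht x hx y hy).2.1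
  · rw [← intervalIntegral.integral_sub
      ((hor hK 1 ⟨zero_le_one, le_rfl⟩).intervalIntegrable_of_Icc hL.le)
      ((hor hK 0 ⟨le_rfl, zero_le_one⟩).intervalIntegrable_of_Icc hL.le),
      intervalIntegral.integral_of_le hL.le, integral_Ioc_eq_integral_Ioo]
    refine setIntegral_congr_fun measurableSet_Ioo fun x hx => ?_
    have hx' := Ioo_subset_Icc_self hx
    exact setIntegral_deriv_Ioo zero_le_one (vert hK x hx') (vert hDK x hx')
      fun y hy => (h t ht x hx y hy).2.2

namespace Channel

/-! ### The gate quadratic -/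

/-- The roots of `gateQuadratic` by the quadratic formula: the larger one for `s = 1`, the smaller
one for `s = -1`. -/
noncomputable def gateRoot (p : Channel) (s : ℝ) : ℝ :=
  (-1 + s * √(1 - 4 * (p.Ws / (2 * √(p.g * p.Hs))) ^ 2)) / (2 * (p.Ws / (2 * √(p.g * p.Hs))))

variable {p : Channel}

theorem gateCoeff_mem (hW₀ : 0 < p.Ws) (hW : p.Ws < √(p.g * p.Hs)) :
    p.Ws / (2 * √(p.g * p.Hs)) ∈ Ioo (0 : ℝ) (1 / 2) := by
  have hc : 0 < √(p.g * p.Hs) := hW₀.trans hW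
  refine ⟨by positivity, ?_⟩
  rw [div_lt_div_iff₀ (by positivity) two_pos]
  linarith

theorem gateRoot_lt (hW₀ : 0 < p.Ws) (hW : p.Ws < √(p.g * p.Hs)) :
    p.gateRoot (-1) < p.gateRoot 1 := by
  obtain ⟨h0, h1⟩ := gateCoeff_mem hW₀ hW
  unfold gateRoot
  set ε := p.Ws / (2 * √(p.g * p.Hs))
  have : 0 < √(1 - 4 * ε ^ 2) := Real.sqrt_pos.2 (by nlinarith)
  exact div_lt_div_of_pos_right (by linarith) (by positivity)

theorem gateQuadratic_eq (hW₀ : 0 < p.Ws) (hW : p.Ws < √(p.g * p.Hs)) (r : ℝ) :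
    p.gateQuadratic r =
      p.Ws / (2 * √(p.g * p.Hs)) * ((r - p.gateRoot (-1)) * (r - p.gateRoot 1)) := by
  obtain ⟨h0, h1⟩ := gateCoeff_mem hW₀ hW
  unfold gateRoot gateQuadratic
  set ε := p.Ws / (2 * √(p.g * p.Hs))
  have hs : √(1 - 4 * ε ^ 2) ^ 2 = 1 - 4 * ε ^ 2 := Real.sq_sqrt (by nlinarith)
  have hε : ε ≠ 0 := h0.ne'
  generalize √(1 - 4 * ε ^ 2) = S at hs
  field_simp
  linear_combination hs

theorem gateQuadratic_eq_zero_iff (hW₀ : 0 < p.Ws) (hW : p.Ws < √(p.g * p.Hs)) (r : ℝ) :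
    p.gateQuadratic r = 0 ↔ r = p.gateRoot (-1) ∨ r = p.gateRoot 1 := by
  rw [gateQuadratic_eq hW₀ hW, mul_eq_zero, mul_eq_zero, sub_eq_zero, sub_eq_zero,
    or_iff_right (gateCoeff_mem hW₀ hW).1.ne']

theorem gateQuadratic_nonpos (hW₀ : 0 < p.Ws) (hW : p.Ws < √(p.g * p.Hs)) {r : ℝ}
    (hr : r ∈ Icc (p.gateRoot (-1)) (p.gateRoot 1)) : p.gateQuadratic r ≤ 0 := by
  rw [gateQuadratic_eq hW₀ hW]
  exact mul_nonpos_of_nonneg_of_nonpos (gateCoeff_mem hW₀ hW).1.le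
    (mul_nonpos_of_nonneg_of_nonpos (sub_nonneg.2 hr.1) (sub_nonpos.2 hr.2))

/-! ### The boundary term for the weights `M - x` -/

theorem normalFlux_eq (hV : p.Vs = 0) (n₁ n₂ : ℝ) (u : State) :
    p.normalFlux n₁ n₂ u =
      n₁ * (p.Ws * (p.htilde u ^ 2 + u 1 ^ 2 + u 2 ^ 2) + 2 * p.c * (p.htilde u * u 1))
        + n₂ * (2 * p.c * (p.htilde u * u 2)) := by
  simp only [normalFlux, symVar, A₁, A₂, hV, Matrix.mulVec, dotProduct, Fin.sum_univ_three,
    Matrix.add_apply, Matrix.smul_apply, Matrix.of_apply, Matrix.cons_val', Matrix.cons_val_zero,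
    Matrix.cons_val_one, Matrix.cons_val, smul_eq_mul]
  ring

/-- The boundary term of the energy weighted by `M - x`. -/
noncomputable def weightedBoundaryTerm (p : Channel) (M : ℝ) (u : ℝ → ℝ → State) : ℝ :=
  (∫ x in (0 : ℝ)..p.L, (M - x) * p.normalFlux 0 (-1) (u x 0)) +
  (∫ x in (0 : ℝ)..p.L, (M - x) * p.normalFlux 0 1 (u x 1)) +
  (∫ y in (0 : ℝ)..1, (M - p.L) * p.normalFlux 1 0 (u p.L y)) +
  (∫ y in (0 : ℝ)..1, M * p.normalFlux (-1) 0 (u 0 y))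

theorem boundaryTerm_eq_weightedBoundaryTerm (u : ℝ → ℝ → State) :
    p.boundaryTerm u = p.weightedBoundaryTerm (2 * p.L) u := by
  simp only [boundaryTerm, weightedBoundaryTerm, weight, sub_zero]

theorem memLp_apply {α : Type*} [MeasurableSpace α] {μ : Measure α} {f : α → State}
    (hf : MemLp f 2 μ) (i : Fin 3) : MemLp (fun x => f x i) 2 μ :=
  (EuclideanSpace.proj (𝕜 := ℝ) i).comp_memLp' hf

theorem intervalIntegrable_weight_mul_normalFlux (hV : p.Vs = 0) {a b : ℝ} (hab : a ≤ b)
    {f : ℝ → State} (hf : MemLp f 2 (volume.restrict (Ioo a b))) {φ : ℝ → ℝ} (hφ : Continuous φ)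
    (n₁ n₂ : ℝ) :
    IntervalIntegrable (fun x => φ x * p.normalFlux n₁ n₂ (f x)) volume a b := by
  refine IntervalIntegrable.continuousOn_mul ?_ hφ.continuousOn
  rw [intervalIntegrable_iff_integrableOn_Ioo_of_le hab]
  have h0 : MemLp (fun x => p.htilde (f x)) 2 (volume.restrict (Ioo a b)) :=
    (memLp_apply hf 0).const_mul _
  have h1 := memLp_apply hf 1
  have h2 := memLp_apply hf 2
  simp only [normalFlux_eq hV]
  exact ((((((h0.integrable_sq.add h1.integrable_sq).add h2.integrable_sq).const_mul _).add
    ((h0.integrable_mul h1).const_mul _)).const_mul _).add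
    (((h0.integrable_mul h2).const_mul _).const_mul _))

theorem right_gate_flux_nonneg (hV : p.Vs = 0) (hW₀ : 0 < p.Ws) {k₁ : ℝ}
    (hk₁ : k₁ ∈ Ioo (-1 : ℝ) 1) {u : State}
    (hu : p.htilde u - u 1 = k₁ * (p.htilde u + u 1)) : 0 ≤ p.normalFlux 1 0 u := by
  have hc : 0 ≤ p.c := Real.sqrt_nonneg _
  have h1 : 0 ≤ 1 - k₁ ^ 2 := by nlinarith [hk₁.1, hk₁.2]
  -- the flux diagonalizes in the Riemann invariants `htilde ± w`
  have key : p.normalFlux 1 0 u = p.Ws * u 2 ^ 2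
      + (p.htilde u + u 1) ^ 2 / 2 * (p.Ws * (1 + k₁ ^ 2) + p.c * (1 - k₁ ^ 2)) := by
    rw [normalFlux_eq hV]
    linear_combination (p.Ws - p.c) / 2 *
      (p.htilde u - u 1 + k₁ * (p.htilde u + u 1)) * hu
  rw [key]
  positivity

theorem left_gate_flux_ge (hV : p.Vs = 0) (hW₀ : 0 < p.Ws) (hW : p.Ws < √(p.g * p.Hs)) {k₂ : ℝ}
    (hk₂ : k₂ ≠ -1) (hq : p.gateQuadratic ((k₂ - 1) / (k₂ + 1)) ≤ 0) {u : State}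
    (hu : p.htilde u + u 1 = k₂ * (p.htilde u - u 1)) :
    -(p.Ws * u 2 ^ 2) ≤ p.normalFlux (-1) 0 u := by
  have hc : 0 < p.c := hW₀.trans hW
  have hk : k₂ + 1 ≠ 0 := fun h => hk₂ (by linarith)
  have hw : u 1 = (k₂ - 1) / (k₂ + 1) * p.htilde u := by
    field_simp
    linear_combination hu
  have hqr : 2 * p.c * p.gateQuadratic ((k₂ - 1) / (k₂ + 1))
      = p.Ws * (1 + ((k₂ - 1) / (k₂ + 1)) ^ 2) + 2 * p.c * ((k₂ - 1) / (k₂ + 1)) := by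
    rw [gateQuadratic, ← c]
    generalize (k₂ - 1) / (k₂ + 1) = r
    field_simp
    ring
  rw [normalFlux_eq hV, hw]
  have : 2 * p.c * p.gateQuadratic ((k₂ - 1) / (k₂ + 1)) * p.htilde u ^ 2 ≤ 0 :=
    mul_nonpos_of_nonpos_of_nonneg (mul_nonpos_of_nonneg_of_nonpos (by positivity) hq)
      (sq_nonneg _)
  rw [hqr] at this
  linarith

theorem spillway_flux_eq (hV : p.Vs = 0) {k₃ : ℝ} {u : State}
    (hu : p.htilde u + u 2 = k₃ * (p.htilde u - u 2)) :
    p.normalFlux 0 (-1) u = p.c / 2 * (1 - k₃ ^ 2) * (p.htilde u - u 2) ^ 2 := by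
  rw [normalFlux_eq hV]
  linear_combination (-p.c / 2) * (p.htilde u + u 2 + k₃ * (p.htilde u - u 2)) * hu

/-- The flux which leaves through the spillway pays for the flux which enters through the left gate
by the transverse feedback. The right gate loses energy, and the walls neither lose nor gain any.
The condition on `k₄` serves all weights `M - x` with `M ≥ 2L`, because `M - 2L/3 ≥ 2M/3`. -/
theorem weightedBoundaryTerm_nonneg (hL : 0 < p.L) (hV : p.Vs = 0) (hW₀ : 0 < p.Ws)
    (hW : p.Ws < √(p.g * p.Hs)) {k₁ k₂ k₃ k₄ M : ℝ} (hM : 2 * p.L ≤ M)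
    (hk₁ : k₁ ∈ Ioo (-1 : ℝ) 1) (hk₂ : k₂ ≠ -1)
    (hq : p.gateQuadratic ((k₂ - 1) / (k₂ + 1)) ≤ 0) (hk₃ : k₃ ∈ Ioo (-1 : ℝ) 1)
    (hk₄ : 9 * p.Ws * k₄ ^ 2 ≤ p.L * p.c * (1 - k₃ ^ 2)) {u : ℝ → ℝ → State}
    (hu : p.SquareIntegrableTraces u) (hbc : p.BoundaryLaws k₁ k₂ k₃ k₄ u) :
    0 ≤ p.weightedBoundaryTerm M u := by
  have hc : 0 < p.c := hW₀.trans hW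
  have h3 : 0 < 1 - k₃ ^ 2 := by nlinarith [hk₃.1, hk₃.2]
  have hM0 : 0 < M := by linarith
  set I := ∫ x in p.L / 3..2 * p.L / 3, (p.htilde (u x 0) - u x 0 2) ^ 2 with hI
  have hI0 : 0 ≤ I := intervalIntegral.integral_nonneg (by linarith) fun x _ => sq_nonneg _
  have hz : ∀ a b : ℝ, IntervalIntegrable (fun _ => (0 : ℝ)) volume a b := fun a b =>
    intervalIntegrable_const
  have upper : 0 ≤ ∫ x in (0 : ℝ)..p.L, (M - x) * p.normalFlux 0 1 (u x 1) := by
    have := intervalIntegral.integral_mono_on_of_le_Ioo hL.le (hz _ _)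
      (intervalIntegrable_weight_mul_normalFlux hV hL.le hu.upper
        (φ := fun x => M - x) (by fun_prop) 0 1)
      fun x hx => by simp [normalFlux_eq hV, hbc.upper_bank x hx]
    simpa using this
  have right : 0 ≤ ∫ y in (0 : ℝ)..1, (M - p.L) * p.normalFlux 1 0 (u p.L y) := by
    have := intervalIntegral.integral_mono_on_of_le_Ioo zero_le_one (hz _ _)
      (intervalIntegrable_weight_mul_normalFlux hV zero_le_one hu.right
        (φ := fun _ => M - p.L) (by fun_prop) 1 0)
      fun y hy => mul_nonneg (by linarith)
        (right_gate_flux_nonneg hV hW₀ hk₁ (hbc.right_gate y hy))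
    simpa using this
  have left : -(M * p.Ws * k₄ ^ 2 * (3 / p.L) * I)
      ≤ ∫ y in (0 : ℝ)..1, M * p.normalFlux (-1) 0 (u 0 y) := by
    have hint : IntervalIntegrable (fun y => u 0 y 2 ^ 2) volume 0 1 := by
      rw [intervalIntegrable_iff_integrableOn_Ioo_of_le zero_le_one]
      exact (memLp_apply hu.left 2).integrable_sq
    have h := intervalIntegral.integral_mono_on_of_le_Ioo zero_le_one
      (hint.const_mul (-(M * p.Ws)))
      (intervalIntegrable_weight_mul_normalFlux hV zero_le_one hu.left
        (φ := fun _ => M) (by fun_prop) (-1) 0)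
      fun y hy => by
        have := mul_le_mul_of_nonneg_left
          (left_gate_flux_ge hV hW₀ hW hk₂ hq (hbc.left_gate y hy)) hM0.le
        linarith
    have hsub : ∫ y in (0 : ℝ)..1, u 0 y 2 ^ 2 = k₄ ^ 2 * (3 / p.L) * I := by
      have h1 : ∫ y in (0 : ℝ)..1, u 0 y 2 ^ 2 = ∫ y in (0 : ℝ)..1, k₄ ^ 2 *
          (fun x => (p.htilde (u x 0) - u x 0 2) ^ 2) (p.L / 3 * y + p.L / 3) := by
        rw [intervalIntegral.integral_of_le zero_le_one, intervalIntegral.integral_of_le zero_le_one,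
          integral_Ioc_eq_integral_Ioo, integral_Ioc_eq_integral_Ioo]
        refine setIntegral_congr_fun measurableSet_Ioo fun y hy => ?_
        simp only [hbc.left_gate_transverse y hy]
        rw [show p.L / 3 * y + p.L / 3 = p.L / 3 * (y + 1) by ring]
        ring
      rw [h1, intervalIntegral.integral_const_mul,
        intervalIntegral.integral_comp_mul_add (fun x => (p.htilde (u x 0) - u x 0 2) ^ 2)
          (show p.L / 3 ≠ 0 by positivity), hI,
        show p.L / 3 * 0 + p.L / 3 = p.L / 3 by ring,
        show p.L / 3 * 1 + p.L / 3 = 2 * p.L / 3 by ring, smul_eq_mul, inv_div, mul_assoc]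
    rw [intervalIntegral.integral_const_mul, hsub] at h
    linarith
  have lower : (M - 2 * p.L / 3) * (p.c / 2 * (1 - k₃ ^ 2)) * I
      ≤ ∫ x in (0 : ℝ)..p.L, (M - x) * p.normalFlux 0 (-1) (u x 0) := by
    have hF := intervalIntegrable_weight_mul_normalFlux hV hL.le hu.lower
        (φ := fun x => M - x) (by fun_prop) 0 (-1)
    have hG : IntervalIntegrable (fun x => (p.htilde (u x 0) - u x 0 2) ^ 2) volume 0 p.L := by
      rw [intervalIntegrable_iff_integrableOn_Ioo_of_le hL.le]
      exact (((memLp_apply hu.lower 0).const_mul _).sub (memLp_apply hu.lower 2)).integrable_sq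
    have hsub : ∀ a b : ℝ, 0 ≤ a → a ≤ b → b ≤ p.L → uIcc a b ⊆ uIcc 0 p.L := by
      intro a b ha hab hb
      rw [uIcc_of_le hab, uIcc_of_le hL.le]
      exact Icc_subset_Icc ha hb
    have s1 := hsub 0 (p.L / 3) le_rfl (by linarith) (by linarith)
    have s2 := hsub (p.L / 3) (2 * p.L / 3) (by linarith) (by linarith) (by linarith)
    have s3 := hsub (2 * p.L / 3) p.L (by linarith) (by linarith) le_rfl
    have s12 := hsub 0 (2 * p.L / 3) le_rfl (by linarith) (by linarith)
    rw [← intervalIntegral.integral_add_adjacent_intervals (hF.mono_set s12) (hF.mono_set s3),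
      ← intervalIntegral.integral_add_adjacent_intervals (hF.mono_set s1) (hF.mono_set s2)]
    have e1 := intervalIntegral.integral_mono_on_of_le_Ioo (by linarith) (hz _ _)
      (hF.mono_set s1) fun x hx => by simp [normalFlux_eq hV, hbc.lower_bank x (.inl hx)]
    have e3 := intervalIntegral.integral_mono_on_of_le_Ioo (by linarith) (hz _ _)
      (hF.mono_set s3) fun x hx => by simp [normalFlux_eq hV, hbc.lower_bank x (.inr hx)]
    have e2 := intervalIntegral.integral_mono_on_of_le_Ioo (by linarith)
      ((hG.mono_set s2).const_mul ((M - 2 * p.L / 3) * (p.c / 2 * (1 - k₃ ^ 2))))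
      (hF.mono_set s2) fun x hx => by
        simp only [spillway_flux_eq hV (hbc.spillway x hx)]
        rw [mul_assoc]
        refine mul_le_mul_of_nonneg_right (by linarith [hx.2]) ?_
        positivity
    rw [intervalIntegral.integral_const_mul] at e2
    simp only [intervalIntegral.integral_zero] at e1 e3
    linarith
  have gain : M * p.Ws * k₄ ^ 2 * (3 / p.L) * I
      ≤ (M - 2 * p.L / 3) * (p.c / 2 * (1 - k₃ ^ 2)) * I := by
    refine mul_le_mul_of_nonneg_right ?_ hI0
    have h4 : 3 * p.Ws * k₄ ^ 2 / p.L ≤ p.c / 3 * (1 - k₃ ^ 2) := by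
      rw [div_le_iff₀ hL]
      linarith
    calc M * p.Ws * k₄ ^ 2 * (3 / p.L) = M * (3 * p.Ws * k₄ ^ 2 / p.L) := by ring
      _ ≤ M * (p.c / 3 * (1 - k₃ ^ 2)) := mul_le_mul_of_nonneg_left h4 hM0.le
      _ = 2 * M / 3 * (p.c / 2 * (1 - k₃ ^ 2)) := by ring
      _ ≤ _ := mul_le_mul_of_nonneg_right (by linarith) (by positivity)
  unfold weightedBoundaryTerm
  linarith

/-! ### The energy balance of fields of class `C¹` -/

/-- The energy density `htilde² + w² + v²` that symmetrizes the system. -/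
noncomputable def energy (p : Channel) (u : State) : ℝ := p.htilde u ^ 2 + u 1 ^ 2 + u 2 ^ 2

theorem energy_nonneg (p : Channel) (u : State) : 0 ≤ p.energy u := by
  unfold energy
  positivity

theorem htilde_sq (hg : 0 < p.g) (hH : 0 < p.Hs) (u : State) :
    p.htilde u ^ 2 = p.g / p.Hs * u 0 ^ 2 := by
  rw [htilde, mul_pow, Real.sq_sqrt (by positivity)]

theorem energy_le (hg : 0 < p.g) (hH : 0 < p.Hs) (u : State) :
    p.energy u ≤ (1 + p.g / p.Hs) * ‖u‖ ^ 2 := by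
  have h : 0 < p.g / p.Hs := by positivity
  rw [energy, htilde_sq hg hH, EuclideanSpace.real_norm_sq_eq, Fin.sum_univ_three]
  nlinarith [sq_nonneg (u 0), mul_nonneg h.le (sq_nonneg (u 1)), mul_nonneg h.le (sq_nonneg (u 2))]

theorem le_energy (hg : 0 < p.g) (hH : 0 < p.Hs) (u : State) :
    min 1 (p.g / p.Hs) * ‖u‖ ^ 2 ≤ p.energy u := by
  rw [energy, htilde_sq hg hH, EuclideanSpace.real_norm_sq_eq, Fin.sum_univ_three]
  have h0 := mul_le_mul_of_nonneg_right (min_le_right 1 (p.g / p.Hs)) (sq_nonneg (u 0))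
  have h1 := mul_le_mul_of_nonneg_right (min_le_left 1 (p.g / p.Hs)) (sq_nonneg (u 1))
  have h2 := mul_le_mul_of_nonneg_right (min_le_left 1 (p.g / p.Hs)) (sq_nonneg (u 2))
  linarith

/-- The bulk density of the energy balance for a weight `φ` with `φ' = -1`, in the symmetric
variables `(a, w, v)` and with a forcing `(f₀, f₁, f₂)`. The derivative of the weight damps the
energy by `W (a² + w² + v²)` up to the indefinite term `2 c a w`, and the drag `2 k φ w²` absorbs that
term once `c² ≤ k W φ`. -/
theorem bulk_density_le {W c k φ M ν a w v f₀ f₁ f₂ : ℝ} (hW : 0 < W) (hk : 0 < k) (hφ : 0 ≤ φ)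
    (hφM : φ ≤ M) (hν : 0 ≤ ν) (hνM : 8 * M * ν ≤ W) (hc : c ^ 2 ≤ k * W * φ) :
    φ * (2 * ν * (a ^ 2 + w ^ 2 + v ^ 2) + 2 * (a * f₀ + w * f₁ + v * f₂)
        - 2 * k * (w ^ 2 + v ^ 2)) - (W * (a ^ 2 + w ^ 2 + v ^ 2) + 2 * c * (a * w))
      ≤ 4 * M ^ 2 / W * (f₀ ^ 2 + f₁ ^ 2 + f₂ ^ 2) := by
  have young : ∀ a f : ℝ, 2 * φ * (a * f) ≤ W / 4 * a ^ 2 + 4 * M ^ 2 / W * f ^ 2 := by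
    intro a f
    have h1 : 4 * φ ^ 2 / W * f ^ 2 ≤ 4 * M ^ 2 / W * f ^ 2 := by gcongr
    have h2 : W / 4 * a ^ 2 + 4 * φ ^ 2 / W * f ^ 2 - 2 * φ * (a * f)
        = (W * a - 4 * φ * f) ^ 2 / (4 * W) := by
      field_simp
      ring
    have h3 : 0 ≤ (W * a - 4 * φ * f) ^ 2 / (4 * W) := by positivity
    linarith
  have hE : 0 ≤ a ^ 2 + w ^ 2 + v ^ 2 := by positivity
  have h1 : φ * (2 * ν) * (a ^ 2 + w ^ 2 + v ^ 2) ≤ W / 4 * (a ^ 2 + w ^ 2 + v ^ 2) := by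
    refine mul_le_mul_of_nonneg_right ?_ hE
    nlinarith [mul_le_mul_of_nonneg_right hφM hν]
  have h2 : -(2 * c * (a * w)) ≤ W / 2 * a ^ 2 + 2 * k * φ * w ^ 2 := by
    have h3 : 2 * (c ^ 2 / W) * w ^ 2 ≤ 2 * k * φ * w ^ 2 := by
      have : c ^ 2 / W ≤ k * φ := by
        rw [div_le_iff₀ hW]
        linarith
      nlinarith [sq_nonneg w]
    have h4 : W / 2 * a ^ 2 + 2 * (c ^ 2 / W) * w ^ 2 + 2 * c * (a * w)
        = (W * a + 2 * c * w) ^ 2 / (2 * W) := by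
      field_simp
      ring
    have h5 : 0 ≤ (W * a + 2 * c * w) ^ 2 / (2 * W) := by positivity
    linarith
  have h6 : 0 ≤ k * φ * v ^ 2 := by positivity
  nlinarith [young a f₀, young w f₁, young v f₂, mul_nonneg hW.le (sq_nonneg w),
    mul_nonneg hW.le (sq_nonneg v)]

theorem residual_eq {U : ℝ → ℝ → ℝ → State} {t x y : ℝ} {Ut Ux Uy : State}
    (ht : HasDerivAt (fun s => U s x y) Ut t) (hx : HasDerivAt (fun s => U t s y) Ux x)
    (hy : HasDerivAt (fun s => U t x s) Uy y) :
    p.residual U (t, x, y) = Ut + Matrix.toEuclideanLin p.Abar₁ Ux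
      + Matrix.toEuclideanLin p.Abar₂ Uy - Matrix.toEuclideanLin p.B (U t x y) := by
  simp only [residual, ht.deriv, hx.deriv, hy.deriv]

/-- The residual of a field of class `C¹` extends continuously up to the boundary. -/
theorem exists_residual_eq {T : ℝ} (hT : 0 < T) (hL : 0 < p.L) {U : ℝ → ℝ → ℝ → State}
    (hU : ContDiffOn ℝ 1 (fun z : ℝ × ℝ × ℝ => U z.1 z.2.1 z.2.2)
      (Icc 0 T ×ˢ Icc 0 p.L ×ˢ Icc 0 1)) :
    ∃ R : ℝ × ℝ × ℝ → State, ContinuousOn R (Icc 0 T ×ˢ Icc 0 p.L ×ˢ Icc 0 1) ∧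
      EqOn (p.residual U) R (Ioo 0 T ×ˢ p.domain) := by
  obtain ⟨Dt, Dx, Dy, ht, hx, hy, h⟩ := exists_continuousOn_partialDeriv hT hL hU
  have hlin : ∀ A : Matrix (Fin 3) (Fin 3) ℝ, Continuous (Matrix.toEuclideanLin A) := fun A =>
    LinearMap.continuous_of_finiteDimensional _
  refine ⟨fun z => Dt z + Matrix.toEuclideanLin p.Abar₁ (Dx z)
    + Matrix.toEuclideanLin p.Abar₂ (Dy z)
    - Matrix.toEuclideanLin p.B (U z.1 z.2.1 z.2.2), ?_, ?_⟩
  · exact ((ht.add ((hlin _).comp_continuousOn hx)).add ((hlin _).comp_continuousOn hy)).sub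
      ((hlin _).comp_continuousOn hU.continuousOn)
  · rintro ⟨t, x, y⟩ ⟨h1, h2, h3⟩
    obtain ⟨d1, d2, d3⟩ := h t h1 x h2 y h3
    exact residual_eq d1 d2 d3

theorem measurableSet_domain : MeasurableSet p.domain := measurableSet_Ioo.prod measurableSet_Ioo

theorem memLp_of_continuousOn {α : Type*} [TopologicalSpace α] [T2Space α] [MeasurableSpace α]
    [OpensMeasurableSpace α] {μ : Measure α} [IsFiniteMeasureOnCompacts μ] {f : α → State}
    {A Q : Set α} (hA : IsCompact A) (hf : ContinuousOn f A) (hQ : Q ⊆ A) :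
    MemLp f 2 (μ.restrict Q) := by
  have h1 : IntegrableOn f A μ := hf.integrableOn_compact hA
  have h2 : IntegrableOn (fun z => ‖f z‖ ^ 2) A μ := (hf.norm.pow 2).integrableOn_compact hA
  exact ((memLp_two_iff_integrable_sq_norm h1.aestronglyMeasurable).2 h2).mono_measure
    (Measure.restrict_mono hQ le_rfl)

theorem openBox_subset {T L : ℝ} :
    (Ioo 0 T ×ˢ Ioo 0 L ×ˢ Ioo 0 1 : Set (ℝ × ℝ × ℝ)) ⊆ Icc 0 T ×ˢ Icc 0 L ×ˢ Icc 0 1 :=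
  prod_mono Ioo_subset_Icc_self (prod_mono Ioo_subset_Icc_self Ioo_subset_Icc_self)

theorem memLp_residual {T : ℝ} (hT : 0 < T) (hL : 0 < p.L) {U : ℝ → ℝ → ℝ → State}
    (hU : ContDiffOn ℝ 1 (fun z : ℝ × ℝ × ℝ => U z.1 z.2.1 z.2.2)
      (Icc 0 T ×ˢ Icc 0 p.L ×ˢ Icc 0 1)) :
    MemLp (p.residual U) 2 (volume.restrict (Ioo 0 T ×ˢ p.domain)) := by
  obtain ⟨R, hR, hUR⟩ := exists_residual_eq hT hL hU
  refine (memLp_congr_ae ?_).2 (memLp_of_continuousOn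
    (isCompact_Icc.prod (isCompact_Icc.prod isCompact_Icc)) hR openBox_subset)
  exact ae_restrict_of_forall_mem (measurableSet_Ioo.prod measurableSet_domain) fun z hz => hUR hz

theorem memLp_slice {T : ℝ} {U : ℝ → ℝ → ℝ → State}
    (hU : ContinuousOn (fun z : ℝ × ℝ × ℝ => U z.1 z.2.1 z.2.2) (Icc 0 T ×ˢ Icc 0 p.L ×ˢ Icc 0 1))
    {t : ℝ} (ht : t ∈ Icc 0 T) :
    MemLp (fun z : ℝ × ℝ => U t z.1 z.2) 2 (volume.restrict p.domain) := by
  have hc : ContinuousOn (fun z : ℝ × ℝ => U t z.1 z.2) (Icc 0 p.L ×ˢ Icc 0 1) :=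
    hU.comp (f := fun z : ℝ × ℝ => (t, z.1, z.2)) (by fun_prop) fun z hz => ⟨ht, hz⟩
  exact memLp_of_continuousOn (isCompact_Icc.prod isCompact_Icc) hc
    (prod_mono Ioo_subset_Icc_self Ioo_subset_Icc_self)

theorem squareIntegrableTraces_of_continuousOn {T : ℝ} (hL : 0 < p.L) {U : ℝ → ℝ → ℝ → State}
    (hU : ContinuousOn (fun z : ℝ × ℝ × ℝ => U z.1 z.2.1 z.2.2) (Icc 0 T ×ˢ Icc 0 p.L ×ˢ Icc 0 1))
    {t : ℝ} (ht : t ∈ Icc 0 T) : p.SquareIntegrableTraces (U t) := by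
  have hor : ∀ y ∈ Icc (0 : ℝ) 1, ContinuousOn (fun x => U t x y) (Icc 0 p.L) := fun y hy =>
    hU.comp (f := fun x : ℝ => (t, x, y)) (by fun_prop) fun x hx => ⟨ht, hx, hy⟩
  have vert : ∀ x ∈ Icc 0 p.L, ContinuousOn (fun y => U t x y) (Icc 0 1) := fun x hx =>
    hU.comp (f := fun y : ℝ => (t, x, y)) (by fun_prop) fun y hy => ⟨ht, hx, hy⟩
  exact ⟨memLp_of_continuousOn isCompact_Icc (hor 0 ⟨le_rfl, zero_le_one⟩) Ioo_subset_Icc_self,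
    memLp_of_continuousOn isCompact_Icc (hor 1 ⟨zero_le_one, le_rfl⟩) Ioo_subset_Icc_self,
    memLp_of_continuousOn isCompact_Icc (vert 0 ⟨le_rfl, hL.le⟩) Ioo_subset_Icc_self,
    memLp_of_continuousOn isCompact_Icc (vert p.L ⟨hL.le, le_rfl⟩) Ioo_subset_Icc_self⟩

theorem normalFlux_neg (n₁ n₂ : ℝ) (u : State) :
    p.normalFlux (-n₁) (-n₂) u = -p.normalFlux n₁ n₂ u := by
  simp only [normalFlux, neg_smul, ← neg_add, Matrix.neg_mulVec, dotProduct_neg]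

theorem hasDerivAt_apply {f : ℝ → State} {f' : State} {t : ℝ} (hf : HasDerivAt f f' t)
    (i : Fin 3) : HasDerivAt (fun s => f s i) (f' i) t :=
  (EuclideanSpace.proj (𝕜 := ℝ) i).hasFDerivAt.comp_hasDerivAt t hf

/-- The divergence of the energy-flux field `e^{2νt} (M - x) (|Ũ|², Ũᵀ A₁ Ũ, Ũᵀ A₂ Ũ)` is bounded
by the residual. -/
theorem divergence_le (hg : 0 < p.g) (hH : 0 < p.Hs) (hk : 0 < p.k) (hV : p.Vs = 0)
    (hW₀ : 0 < p.Ws) {M ν : ℝ} (hν : 0 ≤ ν) (hνM : 8 * M * ν ≤ p.Ws)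
    {U : ℝ → ℝ → ℝ → State} {t x y : ℝ} (hx0 : 0 ≤ x) (hxM : 0 ≤ M - x)
    (hM : p.c ^ 2 ≤ p.k * p.Ws * (M - x)) {Ut Ux Uy : State}
    (ht : HasDerivAt (fun s => U s x y) Ut t) (hx : HasDerivAt (fun s => U t s y) Ux x)
    (hy : HasDerivAt (fun s => U t x s) Uy y) {Ft Gx Ky : ℝ}
    (hFt : HasDerivAt (fun s => Real.exp (2 * ν * s) * ((M - x) * p.energy (U s x y))) Ft t)
    (hGx : HasDerivAt (fun s => Real.exp (2 * ν * t) * ((M - s) * p.normalFlux 1 0 (U t s y))) Gx x)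
    (hKy : HasDerivAt (fun s => Real.exp (2 * ν * t) * ((M - x) * p.normalFlux 0 1 (U t x s)))
      Ky y) :
    Ft + (Gx + Ky)
      ≤ Real.exp (2 * ν * t) * (4 * M ^ 2 / p.Ws * p.energy (p.residual U (t, x, y))) := by
  set s := √(p.g / p.Hs) with hs
  have hs2 : s ^ 2 = p.g / p.Hs := Real.sq_sqrt (by positivity)
  have hsg : s ^ 2 * p.Hs = p.g := by rw [hs2]; field_simp
  have hcs : p.c = s * p.Hs := by
    rw [c, Real.sqrt_eq_iff_mul_self_eq (by positivity) (by positivity)]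
    linear_combination -p.Hs * hsg
  have hres := p.residual_eq ht hx hy
  have r0 : p.residual U (t, x, y) 0 = Ut 0 + p.Ws * Ux 0 + p.Hs * Ux 1 + p.Hs * Uy 2 := by
    rw [hres]
    simp [Matrix.toLpLin_apply, dotProduct, Fin.sum_univ_three, Abar₁, Abar₂, B, hV]
    ring
  have r1 : p.residual U (t, x, y) 1 = Ut 1 + p.g * Ux 0 + p.Ws * Ux 1 + p.k * U t x y 1
      - p.l * U t x y 2 := by
    rw [hres]
    simp [Matrix.toLpLin_apply, dotProduct, Fin.sum_univ_three, Abar₁, Abar₂, B, hV]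
    ring
  have r2 : p.residual U (t, x, y) 2 = Ut 2 + p.Ws * Ux 2 + p.g * Uy 0 + p.l * U t x y 1
      + p.k * U t x y 2 := by
    rw [hres]
    simp [Matrix.toLpLin_apply, dotProduct, Fin.sum_univ_three, Abar₁, Abar₂, B, hV]
    ring
  have ht' := fun i => hasDerivAt_apply ht i
  have hx' := fun i => hasDerivAt_apply hx i
  have hy' := fun i => hasDerivAt_apply hy i
  simp only [normalFlux_eq hV, energy, htilde, ← hs] at hFt hGx hKy ⊢
  have hexp : HasDerivAt (fun s => Real.exp (2 * ν * s)) (Real.exp (2 * ν * t) * (2 * ν * 1)) t :=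
    ((hasDerivAt_id t).const_mul (2 * ν)).exp
  have eF := hFt.unique (hexp.mul ((((((ht' 0).const_mul s).pow 2).add ((ht' 1).pow 2)).add
    ((ht' 2).pow 2)).const_mul (M - x)))
  have eG := hGx.unique ((((hasDerivAt_id x).const_sub M).mul
    (((((((((hx' 0).const_mul s).pow 2).add ((hx' 1).pow 2)).add ((hx' 2).pow 2)).const_mul
      p.Ws).add ((((hx' 0).const_mul s).mul (hx' 1)).const_mul (2 * p.c))).const_mul 1).add
      ((((hx' 0).const_mul s).mul (hx' 2)).const_mul (2 * p.c) |>.const_mul 0))).const_mul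
      (Real.exp (2 * ν * t)))
  have eK := hKy.unique (((((((((((hy' 0).const_mul s).pow 2).add ((hy' 1).pow 2)).add
      ((hy' 2).pow 2)).const_mul
      p.Ws).add ((((hy' 0).const_mul s).mul (hy' 1)).const_mul (2 * p.c))).const_mul 0).add
      ((((hy' 0).const_mul s).mul (hy' 2)).const_mul (2 * p.c) |>.const_mul 1)).const_mul
      (M - x)).const_mul (Real.exp (2 * ν * t)))
  have key := mul_le_mul_of_nonneg_left (bulk_density_le (a := s * U t x y 0) (w := U t x y 1)
    (v := U t x y 2) (f₀ := s * p.residual U (t, x, y) 0) (f₁ := p.residual U (t, x, y) 1)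
    (f₂ := p.residual U (t, x, y) 2) hW₀ hk hxM (show M - x ≤ M by linarith) hν hνM hM)
    (Real.exp_pos (2 * ν * t)).le
  refine le_trans (le_of_eq ?_) key
  rw [eF, eG, eK, r0, r1, r2, hcs]
  simp only [Pi.add_apply, Pi.mul_apply, Pi.pow_apply, id, Nat.cast_ofNat]
  rw [← hsg]
  ring

/-- The energy estimate for fields of class `C¹` with nonnegative boundary term: the weighted energy
decays like `e^{-2νt}` up to the residual. -/
theorem weighted_energy_le (hL : 0 < p.L) (hg : 0 < p.g) (hH : 0 < p.Hs) (hk : 0 < p.k)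
    (hV : p.Vs = 0) (hW₀ : 0 < p.Ws) {M ν T : ℝ} (hν : 0 ≤ ν) (hνM : 8 * M * ν ≤ p.Ws)
    (hLM : p.L ≤ M) (hM : p.c ^ 2 ≤ p.k * p.Ws * (M - p.L)) (hT : 0 < T)
    {U : ℝ → ℝ → ℝ → State}
    (hU : ContDiffOn ℝ 1 (fun z : ℝ × ℝ × ℝ => U z.1 z.2.1 z.2.2)
      (Icc 0 T ×ˢ Icc 0 p.L ×ˢ Icc 0 1))
    (hbc : ∀ t ∈ Icc 0 T, 0 ≤ p.weightedBoundaryTerm M (U t)) :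
    Real.exp (2 * ν * T) * ∫ z in p.domain, (M - z.1) * p.energy (U T z.1 z.2)
      ≤ (∫ z in p.domain, (M - z.1) * p.energy (U 0 z.1 z.2)) +
        Real.exp (2 * ν * T) * (4 * M ^ 2 / p.Ws * (1 + p.g / p.Hs)) *
          ∫ z in Ioo 0 T ×ˢ p.domain, ‖p.residual U z‖ ^ 2 := by
  set A : Set (ℝ × ℝ × ℝ) := Icc 0 T ×ˢ Icc 0 p.L ×ˢ Icc 0 1 with hA
  have hUi : ∀ i, ContDiffOn ℝ 1 (fun z : ℝ × ℝ × ℝ => U z.1 z.2.1 z.2.2 i) A :=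
    contDiffOn_euclidean.1 hU
  have hU0 : ContDiffOn ℝ 1 (fun z : ℝ × ℝ × ℝ => p.htilde (U z.1 z.2.1 z.2.2)) A :=
    contDiffOn_const.mul (hUi 0)
  have hexp : ContDiffOn ℝ 1 (fun z : ℝ × ℝ × ℝ => Real.exp (2 * ν * z.1)) A := by fun_prop
  have hwt : ContDiffOn ℝ 1 (fun z : ℝ × ℝ × ℝ => M - z.2.1) A := by fun_prop
  have hE : ContDiffOn ℝ 1 (fun z : ℝ × ℝ × ℝ => p.energy (U z.1 z.2.1 z.2.2)) A :=
    ((hU0.pow 2).add ((hUi 1).pow 2)).add ((hUi 2).pow 2)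
  have hflux : ∀ n₁ n₂, ContDiffOn ℝ 1
      (fun z : ℝ × ℝ × ℝ => p.normalFlux n₁ n₂ (U z.1 z.2.1 z.2.2)) A := by
    intro n₁ n₂
    simp only [normalFlux_eq hV]
    exact (contDiffOn_const.mul ((contDiffOn_const.mul hE).add
      (contDiffOn_const.mul (hU0.mul (hUi 1))))).add
      (contDiffOn_const.mul (contDiffOn_const.mul (hU0.mul (hUi 2))))
  have hF := hexp.mul (hwt.mul hE)
  have hG := hexp.mul (hwt.mul (hflux 1 0))
  have hK := hexp.mul (hwt.mul (hflux 0 1))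
  obtain ⟨DF, _, _, cF, -, -, dF⟩ := exists_continuousOn_partialDeriv hT hL hF
  obtain ⟨_, DG, _, -, cG, -, dG⟩ := exists_continuousOn_partialDeriv hT hL hG
  obtain ⟨_, _, DK, -, -, cK, dK⟩ := exists_continuousOn_partialDeriv hT hL hK
  obtain ⟨Ut, Ux, Uy, -, -, -, dU⟩ := exists_continuousOn_partialDeriv hT hL hU
  have hdiv := integral_divergence_box hT hL hF.continuousOn hG.continuousOn hK.continuousOn cF cG cK
    fun t ht x hx y hy => ⟨(dF t ht x hx y hy).1, (dG t ht x hx y hy).2.1, (dK t ht x hx y hy).2.2⟩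
  -- the boundary contributes with the favourable sign at every time
  have hbdry : 0 ≤ ∫ t in Ioo 0 T,
      (((∫ y in (0 : ℝ)..1, Real.exp (2 * ν * t) * ((M - p.L) * p.normalFlux 1 0 (U t p.L y)))
        - ∫ y in (0 : ℝ)..1, Real.exp (2 * ν * t) * ((M - 0) * p.normalFlux 1 0 (U t 0 y))) +
      ((∫ x in (0 : ℝ)..p.L, Real.exp (2 * ν * t) * ((M - x) * p.normalFlux 0 1 (U t x 1)))
        - ∫ x in (0 : ℝ)..p.L, Real.exp (2 * ν * t) * ((M - x) * p.normalFlux 0 1 (U t x 0)))) := by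
    refine setIntegral_nonneg measurableSet_Ioo fun t ht => ?_
    have h := mul_nonneg (Real.exp_pos (2 * ν * t)).le (hbc t (Ioo_subset_Icc_self ht))
    have n1 : ∀ u, p.normalFlux (-1) 0 u = -p.normalFlux 1 0 u := fun u => by
      rw [← normalFlux_neg, neg_zero]
    have n2 : ∀ u, p.normalFlux 0 (-1) u = -p.normalFlux 0 1 u := fun u => by
      rw [← normalFlux_neg, neg_zero]
    simp only [weightedBoundaryTerm, n1, n2, mul_neg, intervalIntegral.integral_neg] at h
    simp only [intervalIntegral.integral_const_mul (Real.exp (2 * ν * t)), sub_zero]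
    linarith
  have hres := (memLp_residual hT hL hU).integrable_norm_pow two_ne_zero
  have hbulk : ∫ z in Ioo 0 T ×ˢ Ioo 0 p.L ×ˢ Ioo 0 1, (DF z + (DG z + DK z)) ≤
      Real.exp (2 * ν * T) * (4 * M ^ 2 / p.Ws * (1 + p.g / p.Hs)) *
          ∫ z in Ioo 0 T ×ˢ p.domain, ‖p.residual U z‖ ^ 2 := by
    rw [← integral_const_mul]
    refine setIntegral_mono_on (integrableOn_openBox (cF.add (cG.add cK))) (hres.const_mul _)
      (measurableSet_Ioo.prod measurableSet_domain) ?_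
    rintro ⟨t, x, y⟩ ⟨ht, hx, hy⟩
    obtain ⟨d1, d2, d3⟩ := dU t ht x hx y hy
    have hxL : x ≤ p.L := hx.2.le
    have h1 := divergence_le (U := U) hg hH hk hV hW₀ hν hνM (show 0 ≤ x from hx.1.le) (by linarith)
      (hM.trans (mul_le_mul_of_nonneg_left (by linarith) (by positivity))) d1 d2 d3
      (dF t ht x hx y hy).1 (dG t ht x hx y hy).2.1 (dK t ht x hx y hy).2.2
    refine h1.trans ?_
    have h0 := p.energy_nonneg (p.residual U (t, x, y))
    have h2 := energy_le hg hH (p.residual U (t, x, y))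
    have h3 : 2 * ν * t ≤ 2 * ν * T := mul_le_mul_of_nonneg_left ht.2.le (by positivity)
    calc _ ≤ Real.exp (2 * ν * T) *
          (4 * M ^ 2 / p.Ws * ((1 + p.g / p.Hs) * ‖p.residual U (t, x, y)‖ ^ 2)) := by gcongr
      _ = _ := by ring
  rw [hdiv] at hbulk
  simp only [integral_const_mul (Real.exp _)] at hbulk
  rw [mul_zero, Real.exp_zero, one_mul] at hbulk
  change Real.exp (2 * ν * T) * (∫ z in Ioo 0 p.L ×ˢ Ioo 0 1, _)
    ≤ (∫ z in Ioo 0 p.L ×ˢ Ioo 0 1, _) + _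
  linarith

/-! ### Passage to `L²`-solutions -/

theorem integral_norm_sq_eq {α : Type*} [MeasurableSpace α] {μ : Measure α} {f : α → State}
    (hf : MemLp f 2 μ) : ∫ z, ‖f z‖ ^ 2 ∂μ = (eLpNorm f 2 μ).toReal ^ 2 := by
  have h0 : 0 ≤ ∫ z, ‖f z‖ ^ 2 ∂μ := integral_nonneg fun z => sq_nonneg _
  rw [hf.eLpNorm_eq_integral_rpow_norm two_ne_zero ENNReal.ofNat_ne_top]
  simp only [ENNReal.toReal_ofNat, Real.rpow_two]
  rw [ENNReal.toReal_ofReal (by positivity), ← Real.rpow_natCast, ← Real.rpow_mul h0]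
  norm_num

/-- The energy estimate in terms of `L²`-norms. -/
theorem eLpNorm_sq_le (hL : 0 < p.L) (hg : 0 < p.g) (hH : 0 < p.Hs) (hk : 0 < p.k)
    (hV : p.Vs = 0) (hW₀ : 0 < p.Ws) {M ν T t : ℝ} (hν : 0 ≤ ν) (hνM : 8 * M * ν ≤ p.Ws)
    (hLM : p.L ≤ M) (hM : p.c ^ 2 ≤ p.k * p.Ws * (M - p.L)) (ht : t ∈ Icc 0 T) (hT : 0 < T)
    {U : ℝ → ℝ → ℝ → State}
    (hU : ContDiffOn ℝ 1 (fun z : ℝ × ℝ × ℝ => U z.1 z.2.1 z.2.2)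
      (Icc 0 T ×ˢ Icc 0 p.L ×ˢ Icc 0 1))
    (hbc : ∀ t ∈ Icc 0 T, 0 ≤ p.weightedBoundaryTerm M (U t)) :
    (M - p.L) * min 1 (p.g / p.Hs) *
        (eLpNorm (fun z : ℝ × ℝ => U t z.1 z.2) 2 (volume.restrict p.domain)).toReal ^ 2
      ≤ Real.exp (-(2 * ν * t)) * (M * (1 + p.g / p.Hs)) *
        (eLpNorm (fun z : ℝ × ℝ => U 0 z.1 z.2) 2 (volume.restrict p.domain)).toReal ^ 2 +
        4 * M ^ 2 / p.Ws * (1 + p.g / p.Hs) *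
          (eLpNorm (p.residual U) 2 (volume.restrict (Ioo 0 T ×ˢ p.domain))).toReal ^ 2 := by
  have m0 := memLp_slice hU.continuousOn (left_mem_Icc.2 hT.le)
  have mt := memLp_slice hU.continuousOn ht
  have mr := memLp_residual hT hL hU
  rw [← integral_norm_sq_eq m0, ← integral_norm_sq_eq mt, ← integral_norm_sq_eq mr]
  have hM0 : 0 < M := hL.trans_le hLM
  have hmin : 0 ≤ min 1 (p.g / p.Hs) := le_min zero_le_one (by positivity)
  have iE : ∀ s ∈ Icc 0 T,
      IntegrableOn (fun z : ℝ × ℝ => (M - z.1) * p.energy (U s z.1 z.2)) p.domain := by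
    intro s hs
    have hc : ContinuousOn (fun z : ℝ × ℝ => U s z.1 z.2) (Icc 0 p.L ×ˢ Icc 0 1) :=
      hU.continuousOn.comp (f := fun z : ℝ × ℝ => (s, z.1, z.2)) (by fun_prop)
        fun z hz => ⟨hs, hz⟩
    have hen : Continuous p.energy := by
      unfold energy htilde
      fun_prop
    exact (((by fun_prop : ContinuousOn (fun z : ℝ × ℝ => M - z.1) _).mul
      (hen.comp_continuousOn hc)).integrableOn_compact (isCompact_Icc.prod isCompact_Icc)).mono_set
      (prod_mono Ioo_subset_Icc_self Ioo_subset_Icc_self)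
  have lower : ∀ s ∈ Icc 0 T, (M - p.L) * min 1 (p.g / p.Hs) *
      ∫ z in p.domain, ‖U s z.1 z.2‖ ^ 2 ≤ ∫ z in p.domain, (M - z.1) * p.energy (U s z.1 z.2) := by
    intro s hs
    rw [← integral_const_mul]
    refine setIntegral_mono_on (((memLp_slice hU.continuousOn hs).integrable_norm_pow
      two_ne_zero).const_mul _) (iE s hs) measurableSet_domain fun z hz => ?_
    rw [mul_assoc]
    have hz1 : z.1 ≤ p.L := hz.1.2.le
    exact mul_le_mul (by linarith) (le_energy hg hH _) (by positivity) (by linarith)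
  have upper : ∫ z in p.domain, (M - z.1) * p.energy (U 0 z.1 z.2)
      ≤ M * (1 + p.g / p.Hs) * ∫ z in p.domain, ‖U 0 z.1 z.2‖ ^ 2 := by
    rw [← integral_const_mul]
    refine setIntegral_mono_on (iE 0 (left_mem_Icc.2 hT.le)) ((m0.integrable_norm_pow
      two_ne_zero).const_mul _) measurableSet_domain fun z hz => ?_
    rw [mul_assoc]
    have hz1 : 0 ≤ z.1 := hz.1.1.le
    exact mul_le_mul (by linarith) (energy_le hg hH _) (p.energy_nonneg _) hM0.le
  have hR : 0 ≤ ∫ z in Ioo 0 T ×ˢ p.domain, ‖p.residual U z‖ ^ 2 :=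
    integral_nonneg fun z => sq_nonneg _
  refine (lower t ht).trans ?_
  rcases ht.1.eq_or_lt with rfl | ht0
  · rw [mul_zero, neg_zero, Real.exp_zero, one_mul]
    exact upper.trans (le_add_of_nonneg_right (by positivity))
  have sub : Icc 0 t ⊆ Icc 0 T := Icc_subset_Icc_right ht.2
  have key := weighted_energy_le hL hg hH hk hV hW₀ hν hνM hLM hM ht0
    (hU.mono (prod_mono sub subset_rfl)) fun s hs => hbc s (sub hs)
  have hmono : ∫ z in Ioo 0 t ×ˢ p.domain, ‖p.residual U z‖ ^ 2
      ≤ ∫ z in Ioo 0 T ×ˢ p.domain, ‖p.residual U z‖ ^ 2 :=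
    setIntegral_mono_set (mr.integrable_norm_pow two_ne_zero)
      (Eventually.of_forall fun z => sq_nonneg _)
      (prod_mono (Ioo_subset_Ioo_right ht.2) subset_rfl).eventuallyLE
  have hexp : Real.exp (-(2 * ν * t)) * Real.exp (2 * ν * t) = 1 := by
    rw [← Real.exp_add, neg_add_cancel, Real.exp_zero]
  have h1 := mul_le_mul_of_nonneg_left key (Real.exp_pos (-(2 * ν * t))).le
  rw [← mul_assoc, hexp, one_mul, mul_add, ← mul_assoc, ← mul_assoc, hexp, one_mul] at h1
  refine h1.trans (add_le_add ?_ (mul_le_mul_of_nonneg_left hmono (by positivity)))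
  rw [mul_assoc (Real.exp _)]
  exact mul_le_mul_of_nonneg_left upper (Real.exp_pos _).le

/-- The decay of `L²`-solutions when the boundary term of the weight `M - x` is nonnegative for all
square integrable boundary values. -/
theorem IsL2SolutionOn.norm_le (hL : 0 < p.L) (hg : 0 < p.g) (hH : 0 < p.Hs) (hk : 0 < p.k)
    (hV : p.Vs = 0) (hW₀ : 0 < p.Ws) {M ν k₁ k₂ k₃ k₄ : ℝ} (hν : 0 ≤ ν) (hνM : 8 * M * ν ≤ p.Ws)
    (hLM : p.L < M) (hM : p.c ^ 2 ≤ p.k * p.Ws * (M - p.L))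
    (hbt : ∀ u : ℝ → ℝ → State, p.SquareIntegrableTraces u → p.BoundaryLaws k₁ k₂ k₃ k₄ u →
      0 ≤ p.weightedBoundaryTerm M u) {T : ℝ} (hT : 0 < T) {U : ℝ → p.L2}
    (hU : p.IsL2SolutionOn k₁ k₂ k₃ k₄ T U) {t : ℝ} (ht : t ∈ Icc 0 T) :
    ‖U t‖ ≤ √(M * (1 + p.g / p.Hs) / ((M - p.L) * min 1 (p.g / p.Hs))) * Real.exp (-ν * t)
      * ‖U 0‖ := by
  obtain ⟨-, Un, hC1, hbc, hres, hlim⟩ := hU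
  have hnorm : ∀ s ∈ Icc 0 T, Tendsto (fun n =>
      (eLpNorm (fun z : ℝ × ℝ => Un n s z.1 z.2) 2 (volume.restrict p.domain)).toReal) atTop
      (𝓝 ‖U s‖) := by
    intro s hs
    have hm := fun n => memLp_slice (p := p) (hC1 n).continuousOn hs
    have hsup : Tendsto (fun n => eLpNorm (fun z : ℝ × ℝ => Un n s z.1 z.2 - U s z) 2
        (volume.restrict p.domain)) atTop (𝓝 0) :=
      tendsto_of_tendsto_of_tendsto_of_le_of_le tendsto_const_nhds hlim (fun _ => zero_le)
        fun n => le_iSup₂ (f := fun r (_ : r ∈ Icc 0 T) => eLpNorm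
          (fun z : ℝ × ℝ => Un n r z.1 z.2 - U r z) 2 (volume.restrict p.domain)) s hs
    have hLp : Tendsto (fun n => (hm n).toLp) atTop (𝓝 (U s)) := by
      rw [tendsto_iff_norm_sub_tendsto_zero]
      refine ((ENNReal.tendsto_toReal ENNReal.zero_ne_top).comp hsup).congr fun n => ?_
      rw [Lp.norm_def]
      refine congrArg ENNReal.toReal (eLpNorm_congr_ae ?_)
      filter_upwards [Lp.coeFn_sub (hm n).toLp (U s), (hm n).coeFn_toLp] with z h1 h2
      rw [h1, Pi.sub_apply, h2]
    refine hLp.norm.congr fun n => ?_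
    rw [Lp.norm_toLp]
  have hr := ((ENNReal.tendsto_toReal ENNReal.zero_ne_top).comp hres).pow 2
  simp only [ENNReal.toReal_zero, ne_eq, OfNat.ofNat_ne_zero, not_false_eq_true, zero_pow,
    Function.comp_def] at hr
  have h0 : (0 : ℝ) ∈ Icc 0 T := left_mem_Icc.2 hT.le
  have key := le_of_tendsto_of_tendsto' (((hnorm t ht).pow 2).const_mul _)
    ((((hnorm 0 h0).pow 2).const_mul _).add (hr.const_mul _)) fun n =>
    eLpNorm_sq_le hL hg hH hk hV hW₀ hν hνM hLM.le hM ht hT (hC1 n) fun s hs =>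
      hbt _ (squareIntegrableTraces_of_continuousOn hL (hC1 n).continuousOn hs) (hbc n s hs)
  rw [mul_zero, add_zero] at key
  have hd : 0 < (M - p.L) * min 1 (p.g / p.Hs) :=
    mul_pos (sub_pos.2 hLM) (lt_min one_pos (by positivity))
  have hM0 : 0 < M := hL.trans hLM
  rw [mul_comm, ← le_div_iff₀ hd] at key
  refine (pow_le_pow_iff_left₀ (norm_nonneg _) (by positivity) two_ne_zero).1 ?_
  rw [mul_pow, mul_pow, Real.sq_sqrt (by positivity), ← Real.exp_nat_mul]
  refine key.trans (le_of_eq ?_)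
  rw [show (2 : ℕ) * (-ν * t) = -(2 * ν * t) by push_cast; ring]
  ring

end Channel

theorem mainTheorem2 (p : Channel) (hL : 0 < p.L) (hg : 0 < p.g) (hH : 0 < p.Hs)
    (hk : 0 < p.k) (hl : 0 < p.l)
    (hW₀ : 0 < p.Ws) (hW : p.Ws < √(p.g * p.Hs)) (hV : p.Vs = 0) :
    ∃ r₁ r₂ : ℝ, r₁ < r₂ ∧ (∀ r, p.gateQuadratic r = 0 ↔ r = r₁ ∨ r = r₂) ∧
      ∀ k₃ ∈ Set.Ioo (-1 : ℝ) 1, ∃ δ > 0,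
        ∀ k₁ ∈ Set.Ioo (-1 : ℝ) 1,
        ∀ k₂ : ℝ, k₂ ≠ -1 → (k₂ - 1) / (k₂ + 1) ∈ Set.Icc r₁ r₂ →
        ∀ k₄ : ℝ, |k₄| ≤ δ →
          (∀ u : ℝ → ℝ → State, p.SquareIntegrableTraces u → p.BoundaryLaws k₁ k₂ k₃ k₄ u →
            0 ≤ p.boundaryTerm u) ∧
          ∃ C > 0, ∃ ν > 0,
            (∀ U : ℝ → p.L2, p.IsL2Solution k₁ k₂ k₃ k₄ U →
              ∀ t ≥ 0, ‖U t‖ ≤ C * Real.exp (-ν * t) * ‖U 0‖) ∧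
            (∀ T > 0, ∀ U : ℝ → p.L2, p.IsL2SolutionOn k₁ k₂ k₃ k₄ T U →
              ∀ t ∈ Set.Icc 0 T, ‖U t‖ ≤ C * Real.exp (-ν * t) * ‖U 0‖) := by
  refine ⟨p.gateRoot (-1), p.gateRoot 1, Channel.gateRoot_lt hW₀ hW,
    Channel.gateQuadratic_eq_zero_iff hW₀ hW, fun k₃ hk₃ => ?_⟩
  have hc : 0 < p.c := hW₀.trans hW
  have h3 : 0 < 1 - k₃ ^ 2 := by nlinarith [hk₃.1, hk₃.2]
  have hδ : 0 < p.L * p.c * (1 - k₃ ^ 2) / (9 * p.Ws) := by positivity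
  refine ⟨√(p.L * p.c * (1 - k₃ ^ 2) / (9 * p.Ws)), Real.sqrt_pos.2 hδ,
    fun k₁ hk₁ k₂ hk₂ hr k₄ hk₄ => ?_⟩
  have hk₄' : 9 * p.Ws * k₄ ^ 2 ≤ p.L * p.c * (1 - k₃ ^ 2) := by
    have h := (Real.le_sqrt (abs_nonneg k₄) hδ.le).1 hk₄
    rw [sq_abs] at h
    rw [le_div_iff₀ (by positivity)] at h
    linarith
  have hq := Channel.gateQuadratic_nonpos hW₀ hW hr
  refine ⟨fun u hu hbc => ?_, ?_⟩
  · rw [Channel.boundaryTerm_eq_weightedBoundaryTerm]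
    exact Channel.weightedBoundaryTerm_nonneg hL hV hW₀ hW le_rfl hk₁ hk₂ hq hk₃ hk₄' hu hbc
  -- the second summand of `M` makes the drag absorb the indefinite term of the bulk density
  set M := 2 * p.L + p.c ^ 2 / (p.k * p.Ws) with hMdef
  have hM2 : 2 * p.L ≤ M := le_add_of_nonneg_right (by positivity)
  have hM : p.c ^ 2 ≤ p.k * p.Ws * (M - p.L) := by
    have : p.k * p.Ws * (M - p.L) = p.k * p.Ws * p.L + p.c ^ 2 := by
      rw [hMdef]
      field_simp
      ring
    rw [this]
    exact le_add_of_nonneg_left (by positivity)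
  have hM0 : 0 < M := by linarith
  have hMg : 0 < M - p.L := by linarith
  have hν : 0 < p.Ws / (8 * M) := by positivity
  have main : ∀ T > 0, ∀ U : ℝ → p.L2, p.IsL2SolutionOn k₁ k₂ k₃ k₄ T U → ∀ t ∈ Icc 0 T,
      ‖U t‖ ≤ √(M * (1 + p.g / p.Hs) / ((M - p.L) * min 1 (p.g / p.Hs))) *
        Real.exp (-(p.Ws / (8 * M)) * t) * ‖U 0‖ := fun T hT U hU t ht =>
    hU.norm_le hL hg hH hk hV hW₀ hν.le (by field_simp; rfl) (by linarith) hM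
      (fun u hu hbc =>
        Channel.weightedBoundaryTerm_nonneg hL hV hW₀ hW hM2 hk₁ hk₂ hq hk₃ hk₄' hu hbc) hT ht
  refine ⟨√(M * (1 + p.g / p.Hs) / ((M - p.L) * min 1 (p.g / p.Hs))), ?_, p.Ws / (8 * M), hν,
    fun U hU t ht => ?_, main⟩
  · have : 0 < min 1 (p.g / p.Hs) := lt_min one_pos (by positivity)
    exact Real.sqrt_pos.2 (by positivity)
  · exact main (t + 1) (by linarith) U (hU _ (by linarith)) t ⟨ht, by linarith⟩
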